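/- **Theorem (CLT for the log-partition function).** For each $n\in\mathbb N$ let $G_n=(V_n,E_n)$ be a finite simple graph, and suppose that for all large $n$ the graph $G_n$ is edge-transitive and $|V_n|=c\,n$ for a fixed $c\in\mathbb N$, and that $|E_n|=\Theta(|V_n|^2)$. Let $(\omega_e)_{e\in E_n}$ be i.i.d. random weights with a common law that does not depend on $n$; the value $+\infty$ is allowed (with $e^{-\infty}=0$), but $\omega$ is not almost surely $+\infty$, and $$\psi(\beta):=\log\mathbb E\,e^{-\beta\omega}<\infty\qquad\text{for all }\beta\in(0,\infty).$$ Put $v_\beta^2:=e^{\psi(2\beta)-2\psi(\beta)}-1$. Let $\mathcal S=\mathcal S_n$ be a family of spanning subgraphs of $G_n$, identified with their edge sets, and let $\mathbb P_\pi$ denote the law of a uniformly chosen $\pi\in\mathcal S_n$. A partial matching is a set of pairwise vertex-disjoint edges. Assume that there is a constant $\rho\in(0,\infty)$ such that for all large $n$: 1. every $\pi\in\mathcal S_n$ has exactly $m=m_n$ edges, where $\lim_{n\to\infty} m_n^2/(2|E_n|)=\gamma\in(0,\infty)$; 2. $\mathbb P_\pi(e\in\pi)$ is the same for all $e\in E_n$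 (hence equal to $m/|E_n|$); 3. every partial matching $\Gamma\subseteq E_n$ is contained in some $\pi\in\mathcal S_n$; 4. for every $k$ and every partial matching $\Gamma\subseteq E_n$ with $|\Gamma|=k$, $$\left|\frac{\mathbb P_\pi(\Gamma\subseteq\pi)}{\prod_{e\in\Gamma}\mathbb P_\pi(e\in\pi)}-1\right|\le\frac{\rho^k}{\sqrt m};$$ 5. for every $k$ and every $\Gamma\subseteq E_n$ with $|\Gamma|=k$ that is contained in some element of $\mathcal S_n$ and is not a partial matching, $$\mathbb P_\pi(\Gamma\subseteq\pi)\le\rho^k\prod_{e\in\Gamma}\mathbb P_\pi(e\in\pi).$$ For $\beta\in(0,\infty)$ let $$Z(\beta)=\frac1{|\mathcal S_n|}\sum_{\pi\in\mathcal S_n}\exp\Big(-\beta\sum_{e\in\pi}\omega_e\Big).$$ Then for every fixed $\beta\in(0,\infty)$, $$\log Z(\beta)-m\,\psi(\beta)\ \Rightarrow\ N\big(-\gamma v_\beta^2,\;2\gamma v_\beta^2\big)\qquad(n\to\infty),$$ where $\Rightarrow$ is convergence in distribution (on $[-\infty,\infty]$, with $\log 0=-\infty$), and $N(0,0)$ is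 the point mass at $0$. -/

import Mathlib

open Filter Topology MeasureTheory ProbabilityTheory Asymptotics
open scoped ENNReal NNReal

noncomputable section

namespace RandomOpt

/-- A graph is edge-transitive if its automorphism group acts transitively on its edges. -/
def IsEdgeTransitive {V : Type*} (G : SimpleGraph V) : Prop :=
  ∀ e ∈ G.edgeSet, ∀ f ∈ G.edgeSet, ∃ φ : G ≃g G, Sym2.map φ e = f

/-- A partial matching of `G`: a set of pairwise vertex-disjoint edges. -/
def IsPartialMatching {V : Type*} {G : SimpleGraph V} (Γ : Finset G.edgeSet) : Prop :=
  ∀ e ∈ Γ, ∀ f ∈ Γ, e ≠ f → ∀ v : V, ¬ (v ∈ (e : Sym2 V) ∧ v ∈ (f : Sym2 V))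

open Classical in
/-- The probability that `Γ ⊆ π`, where `π` is uniformly distributed on the finite family `S` of
spanning subgraphs of `G` (each given by its edge set). -/
def inclProb {V : Type*} {G : SimpleGraph V} (S : Finset (Finset G.edgeSet))
    (Γ : Finset G.edgeSet) : ℝ :=
  ((S.filter fun π => Γ ⊆ π).card : ℝ) / (S.card : ℝ)

/-- `𝔼 exp (-β ω)` for a weight `ω` with law `μ`. Weights may take the value `+∞`, in which case
`exp (-β ω) = 0`. -/
def laplace (μ : Measure EReal) (β : ℝ) : ℝ≥0∞ :=
  ∫⁻ x, EReal.exp (-((β : EReal) * x)) ∂μ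

/-- `ψ(β) = log 𝔼 exp (-β ω)`. -/
def psi (μ : Measure EReal) (β : ℝ) : ℝ :=
  Real.log (laplace μ β).toReal

/-- `v_β² = exp (ψ(2β) - 2ψ(β)) - 1`, the variance of `exp (-β ω - ψ(β))`. -/
def vSq (μ : Measure EReal) (β : ℝ) : ℝ :=
  Real.exp (psi μ (2 * β) - 2 * psi μ β) - 1

/-- The weight `W(π) = ∑_{e ∈ π} ω_e` of a configuration. -/
def weight {V : Type*} {G : SimpleGraph V} (w : G.edgeSet → EReal) (π : Finset G.edgeSet) : EReal :=
  ∑ e ∈ π, w e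

/-- The partition function `Z(β) = |S|⁻¹ ∑_{π ∈ S} exp (-β W(π))`. -/
def partitionFn {V : Type*} {G : SimpleGraph V} (S : Finset (Finset G.edgeSet)) (β : ℝ)
    (w : G.edgeSet → EReal) : ℝ≥0∞ :=
  (S.card : ℝ≥0∞)⁻¹ * ∑ π ∈ S, EReal.exp (-((β : EReal) * weight w π))

end RandomOpt

end

/-! Write e^{-βω_e} = e^{ψ(β)}(1 + X_e), with X_e given by `centredFactor`. The X_e are i.i.d.,
centred, at least -1 and of variance v_β². Since every π has m edges, e^{-mψ(β)} Z(β) = ∑_Γ P(Γ ⊆ π)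
∏_{e∈Γ} X_e (`inv_card_mul_sum_prod_one_add`, `log_partitionFn_sub`). If edges were included
independently with probability p = m/|E|, this sum would be the product ∏_{e∈E} (1 + p X_e).

The true sum is close to that product in L². Monomials in the X_e are orthogonal
(`integral_sq_multilinear`), so the squared distance is ∑_Γ (P(Γ ⊆ π) - p^|Γ|)² v_β^{2|Γ|}, bounded
in `sum_sq_inclProb_sub_pow_le`. Matchings contribute at most m⁻¹(1 + ρ²p²v_β²)^|E| = O(1/m),
because p²|E| → 2γ. Every other Γ contains two edges with a common vertex; there are O(|E||V|) such
pairs, each costing O(p⁴), which gives O(|V|/|E|) → 0.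

The logarithm of the product is a sum of |E| ~ 2γ/p² i.i.d. terms log(1 + pX_e) ≈ pX_e - p²X_e²/2,
whence the mean -γv_β² and the variance 2γv_β² (`tendstoInDistribution_sum_log_one_add`). The
limiting product is positive, so an additive error tending to 0 in L¹ disappears after taking
logarithms. -/

namespace RandomOpt

/-! ### Convergence in distribution on varying probability spaces. -/

section ConvergenceInDistribution

variable {ι Ω' : Type*} {Ω : ι → Type*} [∀ i, MeasurableSpace (Ω i)] [MeasurableSpace Ω']
  {P : ∀ i, Measure (Ω i)} [∀ i, IsProbabilityMeasure (P i)]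
  {P' : Measure Ω'} [IsProbabilityMeasure P'] {l : Filter ι}

/-- Convergence in distribution only depends on the tail of the sequence. -/
theorem tendstoInDistribution_congr_eventually {F : Type*} [TopologicalSpace F]
    [MeasurableSpace F] [OpensMeasurableSpace F] {X Y : ∀ i, Ω i → F} {Z : Ω' → F}
    (h : TendstoInDistribution X l Z P P') (hY : ∀ i, AEMeasurable (Y i) (P i))
    (hXY : ∀ᶠ i in l, X i =ᵐ[P i] Y i) : TendstoInDistribution Y l Z P P' where
  forall_aemeasurable := hY
  aemeasurable_limit := h.aemeasurable_limit
  tendsto := by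
    refine h.tendsto.congr' ?_
    filter_upwards [hXY] with i hi
    exact Subtype.ext (Measure.map_congr hi)

/-- Slutsky's theorem for real variables on varying probability spaces, the perturbation tending to
zero in `L¹`. -/
theorem tendstoInDistribution_prodMk_of_tendsto_integral_abs [l.IsCountablyGenerated]
    {X D : ∀ i, Ω i → ℝ} {Z : Ω' → ℝ}
    (h : TendstoInDistribution X l Z P P') (hD : ∀ i, Integrable (D i) (P i))
    (hD0 : Tendsto (fun i => ∫ x, |D i x| ∂(P i)) l (𝓝 0)) :
    TendstoInDistribution (fun i x => (X i x, D i x)) l (fun x => (Z x, (0 : ℝ))) P P' := by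
  have h0 : TendstoInDistribution (fun i x => (X i x, (0 : ℝ))) l (fun x => (Z x, (0 : ℝ))) P P' :=
    h.continuous_comp (g := fun x => (x, (0 : ℝ))) (by fun_prop)
  have hX := h.forall_aemeasurable
  have hDm := fun i => (hD i).aemeasurable
  have hXD : ∀ i, AEMeasurable (fun x => (X i x, D i x)) (P i) := fun i => (hX i).prodMk (hDm i)
  refine ⟨hXD, h0.aemeasurable_limit, ?_⟩
  have h0t := tendsto_iff_forall_lipschitz_integral_tendsto.1 h0.tendsto
  refine tendsto_iff_forall_lipschitz_integral_tendsto.2 ?_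
  rintro F ⟨M, hM⟩ ⟨K, hK⟩
  have hF := hK.continuous
  have key := h0t F ⟨M, hM⟩ ⟨K, hK⟩
  -- For a K-Lipschitz test function, moving the second coordinate from 0 to `D` costs at most K|D|,
  -- so control in L¹ suffices.
  refine tendsto_of_tendsto_of_dist key ?_
  refine squeeze_zero (fun _ => dist_nonneg) (fun i => ?_)
    (by simpa using hD0.const_mul (K : ℝ))
  have hint : ∀ {Y : Ω i → ℝ × ℝ}, AEMeasurable Y (P i) → Integrable (fun x => F (Y x)) (P i) := by
    intro Y hY
    refine Integrable.of_bound (hF.measurable.comp_aemeasurable hY).aestronglyMeasurable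
      (‖F 0‖ + M) (ae_of_all _ fun a => ?_)
    have := hM (Y a) 0
    rw [← sub_le_iff_le_add']
    exact (abs_sub_abs_le_abs_sub _ _).trans this
  have h0m : AEMeasurable (fun x => (X i x, (0 : ℝ))) (P i) := (hX i).prodMk aemeasurable_const
  simp only [ProbabilityMeasure.coe_mk]
  rw [integral_map h0m hF.aestronglyMeasurable, integral_map (hXD i) hF.aestronglyMeasurable,
    dist_eq_norm, ← integral_sub (hint h0m) (hint (hXD i))]
  refine (norm_integral_le_integral_norm _).trans ?_
  rw [← integral_const_mul]
  refine integral_mono_of_nonneg (ae_of_all _ fun _ => norm_nonneg _)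
    ((hD i).abs.const_mul _) (ae_of_all _ fun x => ?_)
  have := hK.dist_le_mul (X i x, 0) (X i x, D i x)
  simpa [dist_eq_norm, Prod.norm_def] using this

end ConvergenceInDistribution

/-! ### Taylor estimates for the logarithm and for (1 + y)^{it}. -/

section Taylor

theorem log_one_add_sub_isBigO :
    (fun y : ℝ => Real.log (1 + y) - (y - y ^ 2 / 2)) =O[𝓝 0] fun y => y ^ 3 := by
  refine IsBigO.of_bound 2 ?_
  have : ∀ᶠ y : ℝ in 𝓝 0, |y| < 1 / 2 :=
    (continuous_abs.tendsto' (0 : ℝ) 0 abs_zero).eventually_lt_const (by norm_num)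
  filter_upwards [this] with y hy
  -- Two terms of the logarithmic series at -y; the remainder |y|³/(1 - |y|) is at most 2|y|³.
  have h := Real.abs_log_sub_add_sum_range_le (x := -y) (by rw [abs_neg]; linarith) 2
  have e : (∑ i ∈ Finset.range 2, (-y) ^ (i + 1) / ((i : ℝ) + 1)) + Real.log (1 - -y)
      = Real.log (1 + y) - (y - y ^ 2 / 2) := by
    simp [Finset.sum_range_succ]; ring_nf
  rw [e, abs_neg] at h
  rw [Real.norm_eq_abs, norm_pow, Real.norm_eq_abs]
  refine h.trans ?_
  rw [div_le_iff₀ (by linarith)]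
  have h3 := pow_nonneg (abs_nonneg y) 3
  have h4 := mul_nonneg h3 (by linarith : 0 ≤ 1 - 2 * |y|)
  norm_num
  linarith

theorem abs_log_one_add_sub_le {y : ℝ} (hy : -(1 / 2) ≤ y) : |Real.log (1 + y) - y| ≤ 2 * y ^ 2 := by
  have h1 : Real.log (1 + y) ≤ y := by
    have := Real.log_le_sub_one_of_pos (x := 1 + y) (by linarith); linarith
  have h2 : 1 - (1 + y)⁻¹ ≤ Real.log (1 + y) := Real.one_sub_inv_le_log_of_pos (by linarith)
  have h3 : y - 2 * y ^ 2 ≤ 1 - (1 + y)⁻¹ := by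
    have hp : 0 < 1 + y := by linarith
    have : 1 - (1 + y)⁻¹ = y / (1 + y) := by field_simp; ring
    rw [this, le_div_iff₀ hp]
    nlinarith [sq_nonneg y, mul_nonneg (sq_nonneg y) (by linarith : (0:ℝ) ≤ 1 + 2 * y)]
  rw [abs_le]; constructor <;> nlinarith [sq_nonneg y]

theorem abs_log_one_add_le {y : ℝ} (hy : -(1 / 2) ≤ y) : |Real.log (1 + y)| ≤ 2 * |y| := by
  have hp : 0 < 1 + y := by linarith
  have h1 : Real.log (1 + y) ≤ y := by
    have := Real.log_le_sub_one_of_pos (x := 1 + y) (by linarith); linarith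
  have h2 : 1 - (1 + y)⁻¹ ≤ Real.log (1 + y) := Real.one_sub_inv_le_log_of_pos (by linarith)
  have h3 : -(2 * |y|) ≤ 1 - (1 + y)⁻¹ := by
    have : 1 - (1 + y)⁻¹ = y / (1 + y) := by field_simp; ring
    rw [this, le_div_iff₀ hp]
    have := neg_abs_le y
    nlinarith [abs_nonneg y]
  rw [abs_le]; constructor <;> linarith [le_abs_self y, abs_nonneg y]

/-- The second-order expansion of `(1 + y) ^ (i t)` at `y = 0`. -/
theorem exp_log_one_add_sub_isBigO (t : ℝ) :
    (fun y : ℝ => Complex.exp (t * Real.log (1 + y) * Complex.I) - 1 - t * y * Complex.I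
      - (-(t * Complex.I + t ^ 2) / 2) * (y : ℂ) ^ 2) =O[𝓝 0] fun y => y ^ 3 := by
  have hl := log_one_add_sub_isBigO
  have hy1 : (fun y : ℝ => y) =O[𝓝 0] fun y : ℝ => y := isBigO_refl _ _
  have hpow : ∀ {k : ℕ}, 1 ≤ k → (fun y : ℝ => y ^ k) =O[𝓝 0] fun y : ℝ => y := by
    intro k hk
    refine IsBigO.of_bound 1 ?_
    filter_upwards [(continuous_norm.tendsto' (0 : ℝ) 0 norm_zero).eventually_lt_const one_pos]
      with y hy
    rw [norm_pow, one_mul]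
    exact pow_le_of_le_one (norm_nonneg _) hy.le (by omega)
  have hl1 : (fun y : ℝ => Real.log (1 + y)) =O[𝓝 0] fun y => y := by
    have := (hl.trans (hpow (by norm_num))).add (hy1.sub ((hpow one_le_two).const_mul_left (1 / 2)))
    refine this.congr_left fun y => ?_
    ring
  have hl2 : (fun y : ℝ => Real.log (1 + y) - y) =O[𝓝 0] fun y => y ^ 2 := by
    have h3 : (fun y : ℝ => y ^ 3) =O[𝓝 0] fun y : ℝ => y ^ 2 := by
      have := (hpow le_rfl).mul (isBigO_refl (fun y : ℝ => y ^ 2) (𝓝 0))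
      have h1 : (fun y : ℝ => y) =O[𝓝 0] fun _ : ℝ => (1 : ℝ) :=
        (continuous_id.tendsto (0 : ℝ)).isBigO_one ℝ
      refine (h1.mul (isBigO_refl (fun y : ℝ => y ^ 2) (𝓝 0))).congr (fun y => by ring)
        (fun y => by ring)
    refine ((hl.trans h3).sub ((isBigO_refl (fun y : ℝ => y ^ 2) (𝓝 0)).const_mul_left
      (1 / 2))).congr_left fun y => ?_
    ring
  have hsq : (fun y : ℝ => Real.log (1 + y) ^ 2 - y ^ 2) =O[𝓝 0] fun y => y ^ 3 :=
    (hl2.mul (hl1.add hy1)).congr (fun y => by ring) (fun y => by ring)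
  have hθ : Tendsto (fun y : ℝ => (t * Real.log (1 + y) * Complex.I : ℂ)) (𝓝 0) (𝓝 0) := by
    have : ContinuousAt (fun y : ℝ => (t * Real.log (1 + y) * Complex.I : ℂ)) 0 := by
      have : ContinuousAt (fun y : ℝ => Real.log (1 + y)) 0 :=
        ContinuousAt.log (by fun_prop) (by norm_num)
      have := Complex.continuous_ofReal.continuousAt.comp this
      exact (continuousAt_const.mul this).mul continuousAt_const
    simpa [ContinuousAt] using this
  have hexp := (Complex.exp_sub_sum_range_isBigO_pow 3).comp_tendsto hθ
  have hθy : (fun y : ℝ => (t * Real.log (1 + y) * Complex.I : ℂ) ^ 3) =O[𝓝 0]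
      fun y : ℝ => y ^ 3 := by
    refine IsBigO.pow ?_ 3
    refine IsBigO.trans (g := fun y : ℝ => Real.log (1 + y)) ?_ hl1
    refine IsBigO.of_bound |t| (Eventually.of_forall fun y => ?_)
    simp
  have hexp' := hexp.trans hθy
  have hlC : (fun y : ℝ => ((Real.log (1 + y) - (y - y ^ 2 / 2) : ℝ) : ℂ)) =O[𝓝 0]
      fun y : ℝ => y ^ 3 := by
    refine IsBigO.trans (IsBigO.of_bound 1 (Eventually.of_forall fun y => ?_)) hl
    rw [Complex.norm_real, one_mul]
  have hsqC : (fun y : ℝ => ((Real.log (1 + y) ^ 2 - y ^ 2 : ℝ) : ℂ)) =O[𝓝 0]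
      fun y : ℝ => y ^ 3 := by
    refine IsBigO.trans (IsBigO.of_bound 1 (Eventually.of_forall fun y => ?_)) hsq
    rw [Complex.norm_real, one_mul]
  refine ((hexp'.add (hlC.const_mul_left (t * Complex.I))).add
    (hsqC.const_mul_left (-(t : ℂ) ^ 2 / 2))).congr_left fun y => ?_
  simp only [Function.comp, Finset.sum_range_succ, Finset.sum_range_zero, Nat.factorial]
  push_cast
  linear_combination (-(t : ℂ) ^ 2 * Real.log (1 + y) ^ 2 / 2) * Complex.I_sq

theorem norm_exp_mul_I_sub_one_sub_le (x : ℝ) :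
    ‖Complex.exp (x * Complex.I) - 1 - x * Complex.I‖ ≤ 3 * x ^ 2 := by
  rcases le_total |x| 1 with h | h
  · have := Complex.norm_exp_sub_one_sub_id_le (x := x * Complex.I) (by simpa using h)
    refine this.trans ?_
    simp only [norm_mul, Complex.norm_real, Complex.norm_I, mul_one, Real.norm_eq_abs, sq_abs]
    nlinarith [sq_nonneg x]
  -- For |x| ≥ 1 the triangle inequality gives 2 + |x| ≤ 3x².
  · have h1 : ‖Complex.exp (x * Complex.I)‖ = 1 := Complex.norm_exp_ofReal_mul_I x
    have h2 := norm_sub_le (Complex.exp (x * Complex.I) - 1) (x * Complex.I)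
    have h3 := norm_sub_le (Complex.exp (x * Complex.I)) 1
    have h4 : ‖(x : ℂ) * Complex.I‖ = |x| := by simp
    rw [h4] at h2
    rw [h1, norm_one] at h3
    rw [← sq_abs]
    nlinarith

/-- This supplies the dominating function for the expansion under the integral, where y is bounded
below but may be large, out of reach of the local estimate at 0. -/
theorem norm_exp_log_one_add_sub_le (t : ℝ) {y : ℝ} (hy : -(1 / 2) ≤ y) :
    ‖Complex.exp (t * Real.log (1 + y) * Complex.I) - 1 - t * y * Complex.I‖
      ≤ (12 * t ^ 2 + 2 * |t|) * y ^ 2 := by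
  have h1 := norm_exp_mul_I_sub_one_sub_le (t * Real.log (1 + y))
  have h2 : ‖((t * (Real.log (1 + y) - y) : ℝ) : ℂ) * Complex.I‖ ≤ |t| * (2 * y ^ 2) := by
    simp only [norm_mul, Complex.norm_real, Complex.norm_I, mul_one, Real.norm_eq_abs]
    gcongr
    exact abs_log_one_add_sub_le hy
  have h3 : (t * Real.log (1 + y)) ^ 2 ≤ t ^ 2 * (4 * y ^ 2) := by
    rw [mul_pow]
    gcongr
    have := pow_le_pow_left₀ (abs_nonneg _) (abs_log_one_add_le hy) 2
    rw [sq_abs, mul_pow, sq_abs] at this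
    linarith
  have e : Complex.exp (t * Real.log (1 + y) * Complex.I) - 1 - t * y * Complex.I
      = (Complex.exp ((t * Real.log (1 + y) : ℝ) * Complex.I) - 1
          - (t * Real.log (1 + y) : ℝ) * Complex.I)
        + ((t * (Real.log (1 + y) - y) : ℝ) : ℂ) * Complex.I := by
    push_cast; ring
  rw [e]
  refine (norm_add_le _ _).trans ?_
  nlinarith

end Taylor

/-! ### Central limit theorem for the logarithm of the product, by characteristic functions. -/

/-- Powers of `1 + z` with `z → 0`, the exponent growing like `w / z`. -/
theorem tendsto_one_add_pow_exp {ι : Type*} {l : Filter ι} {z : ι → ℂ} {N : ι → ℕ} {w : ℂ}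
    (hz : Tendsto z l (𝓝 0)) (hN : Tendsto (fun i => N i * z i) l (𝓝 w)) :
    Tendsto (fun i => (1 + z i) ^ N i) l (𝓝 (Complex.exp w)) := by
  have h1 : Tendsto (fun i => (N i : ℂ) * Complex.log (1 + z i)) l (𝓝 w) := by
    have hd : HasDerivAt (fun z : ℂ => Complex.log (1 + z)) 1 0 := by
      have := (hasDerivAt_id (0 : ℂ)).const_add 1 |>.clog (by simp)
      simpa using this
    have ho : (fun i => Complex.log (1 + z i) - z i) =o[l] z := by
      have := hd.isLittleO.comp_tendsto hz
      simpa [Function.comp_def] using this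
    have ho2 : (fun i => (N i : ℂ) * (Complex.log (1 + z i) - z i)) =o[l] fun i => N i * z i :=
      (isBigO_refl (fun i => (N i : ℂ)) l).mul_isLittleO ho
    have := (ho2.trans_isBigO (hN.isBigO_one ℂ)).tendsto_div_nhds_zero
    simpa [mul_sub] using (by simpa using this : Tendsto (fun i =>
      (N i : ℂ) * (Complex.log (1 + z i) - z i)) l (𝓝 0)).add hN
  refine ((Complex.continuous_exp.tendsto w).comp h1).congr' ?_
  have : ∀ᶠ i in l, 1 + z i ≠ 0 := by
    have : Tendsto (fun i => 1 + z i) l (𝓝 1) := by simpa using hz.const_add 1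
    exact this.eventually_ne one_ne_zero
  filter_upwards [this] with i hi
  rw [Function.comp, Complex.exp_nat_mul, Complex.exp_log hi]

/-- The characteristic function of `log (1 + p X)` for small `p` and a centred `X ≥ -1`. -/
theorem tendsto_integral_exp_log_one_add {ι : Type*} {l : Filter ι} [l.IsCountablyGenerated]
    {ν : Measure ℝ} [IsProbabilityMeasure ν]
    (hν : ∀ᵐ x ∂ν, -1 ≤ x) (h2 : MemLp id 2 ν) (h0 : ∫ x, x ∂ν = 0) {p : ι → ℝ}
    (hp0 : Tendsto p l (𝓝[>] 0)) (t : ℝ) :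
    Tendsto (fun i => ((p i : ℂ) ^ 2)⁻¹ *
      ((∫ x, Complex.exp (t * Real.log (1 + p i * x) * Complex.I) ∂ν) - 1)) l
      (𝓝 (-(t * Complex.I + t ^ 2) / 2 * (∫ x, x ^ 2 ∂ν : ℝ))) := by
  have hp : Tendsto p l (𝓝 0) := hp0.mono_right nhdsWithin_le_nhds
  have hpos : ∀ᶠ i in l, 0 < p i := hp0.eventually self_mem_nhdsWithin
  have hsmall : ∀ᶠ i in l, p i < 1 / 2 := hp.eventually_lt_const (by norm_num)
  have hint1 : Integrable (fun x : ℝ => x) ν := h2.integrable one_le_two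
  have hint2 : Integrable (fun x : ℝ => x ^ 2) ν := h2.integrable_sq
  have hm : ∀ i, Measurable fun x : ℝ =>
      Complex.exp (t * Real.log (1 + p i * x) * Complex.I) := by
    intro i
    have : Measurable fun x : ℝ => Real.log (1 + p i * x) := by fun_prop
    fun_prop
  -- The linear term is removed before dividing by p²: it is too large pointwise, but its integral
  -- is 0 because `ν` is centred.
  set F : ι → ℝ → ℂ := fun i x => ((p i : ℂ) ^ 2)⁻¹ *
    (Complex.exp (t * Real.log (1 + p i * x) * Complex.I) - 1 - t * (p i * x : ℝ) * Complex.I)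
  have hlim : Tendsto (fun i => ∫ x, F i x ∂ν) l
      (𝓝 (∫ x : ℝ, -(t * Complex.I + t ^ 2) / 2 * ((x ^ 2 : ℝ) : ℂ) ∂ν)) := by
    refine tendsto_integral_filter_of_dominated_convergence
      (fun x => (12 * t ^ 2 + 2 * |t|) * x ^ 2) ?_ ?_ (hint2.const_mul _) ?_
    · refine Eventually.of_forall fun i => Measurable.aestronglyMeasurable ?_
      have := hm i
      fun_prop
    · filter_upwards [hpos, hsmall] with i hi hi'
      filter_upwards [hν] with x hx
      have := norm_exp_log_one_add_sub_le t (y := p i * x) (by nlinarith)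
      simp only [F, norm_mul, norm_inv, norm_pow, Complex.norm_real, Real.norm_eq_abs, sq_abs]
      rw [inv_mul_le_iff₀ (by positivity)]
      refine this.trans (le_of_eq ?_)
      ring
    · refine ae_of_all _ fun x => ?_
      have hpx : Tendsto (fun i => p i * x) l (𝓝 0) := by simpa using hp.mul_const x
      have hO := (exp_log_one_add_sub_isBigO t).comp_tendsto hpx
      have hO' : (fun i => F i x - -(t * Complex.I + t ^ 2) / 2 * ((x ^ 2 : ℝ) : ℂ)) =O[l]
          fun i => (p i) := by
        have h1 : (fun i => ((p i : ℂ) ^ 2)⁻¹) =O[l] fun i => ((p i) ^ 2)⁻¹ :=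
          IsBigO.of_bound 1 (Eventually.of_forall fun i => by simp)
        have h3 : (fun i => (p i * x) ^ 3) =O[l] fun i => p i ^ 3 :=
          IsBigO.of_bound |x ^ 3| (Eventually.of_forall fun i => by
            simp only [Real.norm_eq_abs, mul_pow, abs_mul]; rw [mul_comm])
        refine (h1.mul (hO.trans h3)).congr' ?_ ?_
        · filter_upwards [hpos] with i hi
          have : (p i : ℂ) ≠ 0 := by exact_mod_cast hi.ne'
          simp only [F, Function.comp]
          push_cast
          field_simp
        · filter_upwards [hpos] with i hi
          field_simp
      have := (hO'.trans_tendsto hp).add_const (-(t * Complex.I + t ^ 2) / 2 * ((x ^ 2 : ℝ) : ℂ))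
      simpa only [sub_add_cancel, zero_add] using this
  rw [integral_const_mul, integral_complex_ofReal] at hlim
  refine hlim.congr fun i => ?_
  have hi1 : Integrable (fun x : ℝ => Complex.exp (t * Real.log (1 + p i * x) * Complex.I)) ν := by
    refine Integrable.of_bound (hm i).aestronglyMeasurable 1 (ae_of_all _ fun x => ?_)
    rw [← Complex.ofReal_mul, Complex.norm_exp_ofReal_mul_I]
  have hi2 : Integrable (fun x : ℝ => (t : ℂ) * (p i * x : ℝ) * Complex.I) ν :=
    (((hint1.const_mul (p i)).ofReal).const_mul _).mul_const _
  have hz : ∫ x : ℝ, (t : ℂ) * (p i * x : ℝ) * Complex.I ∂ν = 0 := by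
    rw [integral_mul_const, integral_const_mul, integral_complex_ofReal, integral_const_mul, h0]
    simp
  simp only [F]
  have hi3 : Integrable (fun x : ℝ =>
      Complex.exp (t * Real.log (1 + p i * x) * Complex.I) - 1) ν := hi1.sub (integrable_const _)
  rw [integral_const_mul, integral_sub hi3 hi2, hz, integral_sub hi1 (integrable_const _)]
  simp

/-- Central limit theorem for `∑ log (1 + p X_e)`, the `X_e` being i.i.d. and centred, when the
number of summands grows like `p⁻²`. -/
theorem tendstoInDistribution_sum_log_one_add {E : ℕ → Type*} [∀ n, Fintype (E n)]
    {Ω : ℕ → Type*} [∀ n, MeasurableSpace (Ω n)]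
    {P : ∀ n, Measure (Ω n)} [∀ n, IsProbabilityMeasure (P n)]
    {X : ∀ n, E n → Ω n → ℝ} {ν : Measure ℝ} [IsProbabilityMeasure ν]
    (hlaw : ∀ n e, HasLaw (X n e) ν (P n)) (hindep : ∀ n, iIndepFun (X n) (P n))
    (hν : ∀ᵐ x ∂ν, -1 ≤ x) (h2 : MemLp id 2 ν) (h0 : ∫ x, x ∂ν = 0) {p : ℕ → ℝ}
    (hp0 : Tendsto p atTop (𝓝[>] 0)) {g : ℝ} (hg : 0 ≤ g)
    (hpg : Tendsto (fun n => p n ^ 2 * Fintype.card (E n)) atTop (𝓝 (2 * g))) :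
    TendstoInDistribution (fun n x => ∑ e, Real.log (1 + p n * X n e x)) atTop (fun x : ℝ => x) P
      (gaussianReal (-(g * ∫ x, x ^ 2 ∂ν)) (2 * g * ∫ x, x ^ 2 ∂ν).toNNReal) where
  forall_aemeasurable n := by
    have := fun e => (hlaw n e).aemeasurable
    fun_prop
  tendsto := by
    refine ProbabilityMeasure.tendsto_of_tendsto_charFun fun t => ?_
    simp only [ProbabilityMeasure.coe_mk]
    have hv : 0 ≤ 2 * g * ∫ x, x ^ 2 ∂ν :=
      mul_nonneg (by positivity) (integral_nonneg fun x => sq_nonneg x)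
    rw [show (fun x : ℝ => x) = id from rfl, Measure.map_id, charFun_gaussianReal,
      Real.coe_toNNReal _ hv]
    have hcf : ∀ n, charFun ((P n).map fun x => ∑ e, Real.log (1 + p n * X n e x)) t
        = (1 + ((∫ x, Complex.exp (t * Real.log (1 + p n * x) * Complex.I) ∂ν) - 1))
          ^ Fintype.card (E n) := by
      intro n
      have hae := fun e => (hlaw n e).aemeasurable
      have hmeas : Measurable fun x : ℝ => Real.log (1 + p n * x) := by fun_prop
      have hind : iIndepFun (fun e x => Real.log (1 + p n * X n e x)) (P n) :=
        (hindep n).comp (fun _ x => Real.log (1 + p n * x)) fun _ => hmeas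
      rw [iIndepFun.charFun_map_fun_finsetSum_eq_prod (s := Finset.univ)
        (X := fun e x => Real.log (1 + p n * X n e x)) (fun e _ => by fun_prop)
        (hind.restrict _), Finset.prod_apply]
      rw [Finset.prod_congr rfl (g := fun _ =>
        ∫ x, Complex.exp (t * Real.log (1 + p n * x) * Complex.I) ∂ν), Finset.prod_const,
        Finset.card_univ]
      · simp
      intro e _
      have : HasLaw (fun x => Real.log (1 + p n * X n e x))
          (ν.map fun x => Real.log (1 + p n * x)) (P n) :=
        HasLaw.comp (Y := fun x : ℝ => Real.log (1 + p n * x)) (μ := ν)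
          ⟨hmeas.aemeasurable, rfl⟩ (hlaw n e)
      rw [this.map_eq, charFun_apply_real, integral_map hmeas.aemeasurable (by fun_prop)]
    have hT := tendsto_integral_exp_log_one_add hν h2 h0 hp0 t
    have hp : Tendsto p atTop (𝓝 0) := hp0.mono_right nhdsWithin_le_nhds
    have hpos : ∀ᶠ i in atTop, 0 < p i := hp0.eventually self_mem_nhdsWithin
    have hp2 : Tendsto (fun n => (p n : ℂ) ^ 2) atTop (𝓝 0) := by
      have := (Complex.continuous_ofReal.tendsto 0).comp hp
      simpa [Function.comp_def] using this.pow 2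
    have hcard : Tendsto (fun n => (p n : ℂ) ^ 2 * Fintype.card (E n)) atTop
        (𝓝 ((2 * g : ℝ) : ℂ)) := by
      have := (Complex.continuous_ofReal.tendsto (2 * g)).comp hpg
      simpa [Function.comp_def] using this
    simp_rw [hcf]
    -- With σ the second moment, 2g · (-(it + t²)/2)σ = it(-gσ) - t²(2gσ)/2, the Gaussian exponent;
    -- σ = 0 needs no separate case.
    convert tendsto_one_add_pow_exp (w := ((2 * g : ℝ) : ℂ) *
      (-(t * Complex.I + t ^ 2) / 2 * (∫ x, x ^ 2 ∂ν : ℝ))) ?_ ?_ using 2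
    · push_cast; ring_nf
    · have h := hp2.mul hT
      rw [zero_mul] at h
      refine h.congr' ?_
      filter_upwards [hpos] with n hn
      have : (p n : ℂ) ≠ 0 := by exact_mod_cast hn.ne'
      rw [mul_inv_cancel_left₀ (pow_ne_zero 2 this)]
    · refine (hcard.mul hT).congr' ?_
      filter_upwards [hpos] with n hn
      have : (p n : ℂ) ≠ 0 := by exact_mod_cast hn.ne'
      rw [mul_mul_mul_comm, mul_inv_cancel₀ (pow_ne_zero 2 this), one_mul]

/-! ### Weighted sums over edge sets and inclusion probabilities. -/

section Combinatorics

open Classical in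
-- Deleting e and f is injective on the sets containing both and extracts q²; the sum over all
-- remaining sets is at most (1 + q)^|E| by the binomial theorem.
theorem sum_pow_card_filter_pair_le {E : Type*} [Fintype E] {q : ℝ} (hq : 0 ≤ q) {e f : E}
    (hef : e ≠ f) :
    ∑ Γ : Finset E with e ∈ Γ ∧ f ∈ Γ, q ^ Γ.card ≤ q ^ 2 * (1 + q) ^ Fintype.card E := by
  have hsub : ∀ Γ ∈ (Finset.univ.filter fun Γ : Finset E => e ∈ Γ ∧ f ∈ Γ), {e, f} ⊆ Γ := by
    intro Γ hΓ
    simp only [Finset.mem_filter, Finset.mem_univ, true_and] at hΓ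
    simp [Finset.insert_subset_iff, hΓ]
  calc ∑ Γ : Finset E with e ∈ Γ ∧ f ∈ Γ, q ^ Γ.card
      = ∑ Γ : Finset E with e ∈ Γ ∧ f ∈ Γ, q ^ 2 * q ^ (Γ \ {e, f}).card := by
        refine Finset.sum_congr rfl fun Γ hΓ => ?_
        rw [← pow_add, ← Finset.card_sdiff_add_card_eq_card (hsub Γ hΓ), Finset.card_pair hef,
          add_comm]
    _ = q ^ 2 * ∑ Δ ∈ (Finset.univ.filter fun Γ : Finset E => e ∈ Γ ∧ f ∈ Γ).image (· \ {e, f}),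
          q ^ Δ.card := by
        rw [← Finset.mul_sum, Finset.sum_image]
        intro Γ hΓ Δ hΔ h
        rw [← Finset.sdiff_union_of_subset (hsub Γ hΓ), ← Finset.sdiff_union_of_subset (hsub Δ hΔ)]
        simp only at h
        rw [h]
    _ ≤ q ^ 2 * ∑ Δ : Finset E, q ^ Δ.card := by
        gcongr
        exact Finset.subset_univ _
    _ = q ^ 2 * (1 + q) ^ Fintype.card E := by
        have := Fintype.sum_pow_mul_eq_add_pow E q 1
        simp only [one_pow, mul_one] at this
        rw [this, add_comm]

open Classical in
theorem card_filter_mem_edge_le {V : Type*} [Fintype V] {G : SimpleGraph V} [Fintype G.edgeSet]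
    (a : V) : (Finset.univ.filter fun f : G.edgeSet => a ∈ (f : Sym2 V)).card ≤ Fintype.card V := by
  rw [← Finset.card_image_of_injective _ Subtype.val_injective]
  calc _ ≤ (Finset.univ.image fun w : V => s(a, w)).card := by
        refine Finset.card_le_card fun f hf => ?_
        simp only [Finset.mem_image, Finset.mem_filter, Finset.mem_univ, true_and] at hf ⊢
        obtain ⟨g, hg, rfl⟩ := hf
        obtain ⟨w, hw⟩ := hg
        exact ⟨w, hw.symm⟩
    _ ≤ _ := Finset.card_image_le

open Classical in
-- Each of the two endpoints of an edge lies on at most |V| edges.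
theorem card_adjacent_edge_pairs_le {V : Type*} [Fintype V] {G : SimpleGraph V}
    [Fintype G.edgeSet] :
    (Finset.univ.filter fun x : G.edgeSet × G.edgeSet =>
      x.1 ≠ x.2 ∧ ∃ v, v ∈ (x.1 : Sym2 V) ∧ v ∈ (x.2 : Sym2 V)).card
      ≤ Fintype.card G.edgeSet * (2 * Fintype.card V) := by
  calc _ ≤ (Finset.univ.sigma fun e : G.edgeSet => Finset.univ.filter fun f : G.edgeSet =>
        ∃ v, v ∈ (e : Sym2 V) ∧ v ∈ (f : Sym2 V)).card := by
        refine Finset.card_le_card_of_injOn (fun x => ⟨x.1, x.2⟩) ?_ ?_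
        · intro x hx
          simp only [Finset.coe_filter, Finset.mem_univ, true_and, Set.mem_ofPred_eq] at hx
          simpa using hx.2
        · rintro ⟨a, b⟩ - ⟨c, d⟩ - h
          simpa using h
    _ = ∑ e : G.edgeSet, (Finset.univ.filter fun f : G.edgeSet =>
        ∃ v, v ∈ (e : Sym2 V) ∧ v ∈ (f : Sym2 V)).card := Finset.card_sigma _ _
    _ ≤ ∑ _e : G.edgeSet, 2 * Fintype.card V := by
        refine Finset.sum_le_sum fun e _ => ?_
        obtain ⟨⟨a, b⟩, he⟩ := e
        refine (Finset.card_le_card (t := (Finset.univ.filter fun f : G.edgeSet =>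
          a ∈ (f : Sym2 V)) ∪ Finset.univ.filter fun f : G.edgeSet => b ∈ (f : Sym2 V)) ?_).trans
          ((Finset.card_union_le _ _).trans ?_)
        · intro f hf
          simp only [Finset.mem_filter, Finset.mem_univ, true_and, Finset.mem_union] at hf ⊢
          obtain ⟨v, hv, hf⟩ := hf
          rcases Sym2.mem_iff.1 hv with rfl | rfl
          · exact Or.inl hf
          · exact Or.inr hf
        · rw [two_mul]
          exact add_le_add (card_filter_mem_edge_le a) (card_filter_mem_edge_le b)
    _ = _ := by simp

open Classical in
-- Union bound: a set in `A` is charged to every pair of `T` that it contains.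
theorem sum_pow_card_le_of_exists_pair {E : Type*} [Fintype E] {q : ℝ} (hq : 0 ≤ q)
    {A : Finset (Finset E)} {T : Finset (E × E)} (hT : ∀ x ∈ T, x.1 ≠ x.2)
    (hA : ∀ Γ ∈ A, ∃ x ∈ T, x.1 ∈ Γ ∧ x.2 ∈ Γ) :
    ∑ Γ ∈ A, q ^ Γ.card ≤ T.card * (q ^ 2 * (1 + q) ^ Fintype.card E) := by
  have hnn : ∀ Γ : Finset E, ∀ x ∈ T, 0 ≤ if x.1 ∈ Γ ∧ x.2 ∈ Γ then q ^ Γ.card else 0 :=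
    fun Γ x _ => by split_ifs <;> positivity
  calc ∑ Γ ∈ A, q ^ Γ.card
      ≤ ∑ Γ ∈ A, ∑ x ∈ T, if x.1 ∈ Γ ∧ x.2 ∈ Γ then q ^ Γ.card else 0 := by
        refine Finset.sum_le_sum fun Γ hΓ => ?_
        obtain ⟨x, hx, hxΓ⟩ := hA Γ hΓ
        refine le_trans ?_ (Finset.single_le_sum (hnn Γ) hx)
        simp [hxΓ]
    _ ≤ ∑ Γ : Finset E, ∑ x ∈ T, if x.1 ∈ Γ ∧ x.2 ∈ Γ then q ^ Γ.card else 0 :=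
        Finset.sum_le_sum_of_subset_of_nonneg (Finset.subset_univ _)
          fun Γ _ _ => Finset.sum_nonneg (hnn Γ)
    _ = ∑ x ∈ T, ∑ Γ : Finset E with x.1 ∈ Γ ∧ x.2 ∈ Γ, q ^ Γ.card := by
        rw [Finset.sum_comm]
        simp_rw [Finset.sum_filter]
    _ ≤ T.card • (q ^ 2 * (1 + q) ^ Fintype.card E) :=
        Finset.sum_le_card_nsmul _ _ _ fun x hx => sum_pow_card_filter_pair_le hq (hT x hx)
    _ = _ := nsmul_eq_mul _ _

open Classical in
/-- The edge sets which are not partial matchings have small weight. -/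
theorem sum_pow_card_not_isPartialMatching_le {V : Type*} [Fintype V] {G : SimpleGraph V}
    [Fintype G.edgeSet] {q : ℝ} (hq : 0 ≤ q) :
    ∑ Γ : Finset G.edgeSet with ¬ IsPartialMatching Γ, q ^ Γ.card
      ≤ Fintype.card G.edgeSet * (2 * Fintype.card V) *
        (q ^ 2 * (1 + q) ^ Fintype.card G.edgeSet) := by
  refine (sum_pow_card_le_of_exists_pair hq (T := Finset.univ.filter
    fun x : G.edgeSet × G.edgeSet =>
      x.1 ≠ x.2 ∧ ∃ v, v ∈ (x.1 : Sym2 V) ∧ v ∈ (x.2 : Sym2 V)) ?_ ?_).trans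
    (mul_le_mul_of_nonneg_right ?_ (by positivity))
  · exact fun x hx => (Finset.mem_filter.1 hx).2.1
  · intro Γ hΓ
    have h := (Finset.mem_filter.1 hΓ).2
    simp only [IsPartialMatching, not_forall, not_not] at h
    obtain ⟨e, he, f, hf, hne, v, hv⟩ := h
    exact ⟨(e, f), Finset.mem_filter.2 ⟨Finset.mem_univ _, hne, v, hv⟩, he, hf⟩
  · exact_mod_cast card_adjacent_edge_pairs_le

open Classical in
/-- Expansion of the normalized partition function over edge sets. -/
theorem inv_card_mul_sum_prod_one_add {V : Type*} {G : SimpleGraph V} [Fintype G.edgeSet]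
    (S : Finset (Finset G.edgeSet)) (x : G.edgeSet → ℝ) :
    (S.card : ℝ)⁻¹ * ∑ π ∈ S, ∏ e ∈ π, (1 + x e)
      = ∑ Γ : Finset G.edgeSet, inclProb S Γ * ∏ e ∈ Γ, x e := by
  have h : ∀ π : Finset G.edgeSet, ∏ e ∈ π, (1 + x e)
      = ∑ Γ : Finset G.edgeSet, if Γ ⊆ π then ∏ e ∈ Γ, x e else 0 := by
    intro π
    rw [Finset.prod_one_add, ← Finset.sum_filter]
    refine Finset.sum_congr ?_ fun _ _ => rfl
    ext Γ; simp
  simp_rw [h]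
  rw [Finset.sum_comm, Finset.mul_sum]
  refine Finset.sum_congr rfl fun Γ _ => ?_
  rw [← Finset.sum_filter, Finset.sum_const, nsmul_eq_mul, inclProb]
  ring

open Classical in
-- Double counting of the incidences e ∈ π; it identifies the common edge probability as m/|E|.
theorem sum_inclProb_singleton {V : Type*} {G : SimpleGraph V} [Fintype G.edgeSet]
    {S : Finset (Finset G.edgeSet)} (hS : S.Nonempty) {m : ℕ} (hm : ∀ π ∈ S, π.card = m) :
    ∑ e : G.edgeSet, inclProb S {e} = m := by
  have hc : (S.card : ℝ) ≠ 0 := by exact_mod_cast hS.card_ne_zero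
  simp only [inclProb, ← Finset.sum_div]
  rw [div_eq_iff hc]
  simp only [Finset.card_filter, Finset.singleton_subset_iff]
  push_cast
  rw [Finset.sum_comm, Finset.sum_congr rfl (g := fun _ => (m : ℝ))]
  · simp [mul_comm]
  · intro π hπ
    simp [hm π hπ]

theorem inclProb_nonneg {V : Type*} {G : SimpleGraph V} (S : Finset (Finset G.edgeSet))
    (Γ : Finset G.edgeSet) : 0 ≤ inclProb S Γ := by
  unfold inclProb; positivity

open Classical in
theorem inclProb_eq_zero {V : Type*} {G : SimpleGraph V} {S : Finset (Finset G.edgeSet)}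
    {Γ : Finset G.edgeSet} (h : ¬ ∃ π ∈ S, Γ ⊆ π) : inclProb S Γ = 0 := by
  have : S.filter (fun π => Γ ⊆ π) = ∅ :=
    Finset.filter_eq_empty_iff.2 fun π hπ hΓ => h ⟨π, hπ, hΓ⟩
  rw [inclProb, this]
  simp

open Classical in
/-- The `L²` distance between the expansion with coefficients `inclProb S Γ` and the one with
coefficients `p ^ |Γ|`. -/
theorem sum_sq_inclProb_sub_pow_le {V : Type*} [Fintype V] {G : SimpleGraph V}
    [Fintype G.edgeSet] {S : Finset (Finset G.edgeSet)} {p ρ₁ ρ₂ m σ : ℝ} (hp : 0 < p)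
    (hm : 0 < m) (hσ : 0 ≤ σ) (hρ₂ : 1 ≤ ρ₂)
    (hpS : ∀ e, inclProb S {e} = p)
    (h₁ : ∀ Γ : Finset G.edgeSet, IsPartialMatching Γ →
      |inclProb S Γ / (∏ e ∈ Γ, inclProb S {e}) - 1| ≤ ρ₁ ^ Γ.card / √m)
    (h₂ : ∀ Γ : Finset G.edgeSet, (∃ π ∈ S, Γ ⊆ π) → ¬ IsPartialMatching Γ →
      inclProb S Γ ≤ ρ₂ ^ Γ.card * ∏ e ∈ Γ, inclProb S {e}) :
    ∑ Γ : Finset G.edgeSet, (inclProb S Γ - p ^ Γ.card) ^ 2 * σ ^ Γ.card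
      ≤ m⁻¹ * (1 + ρ₁ ^ 2 * p ^ 2 * σ) ^ Fintype.card G.edgeSet +
        Fintype.card G.edgeSet * (2 * Fintype.card V) * ((ρ₂ ^ 2 * p ^ 2 * σ) ^ 2 *
          (1 + ρ₂ ^ 2 * p ^ 2 * σ) ^ Fintype.card G.edgeSet) := by
  rw [← Finset.sum_filter_add_sum_filter_not Finset.univ
    (fun Γ : Finset G.edgeSet => IsPartialMatching Γ)]
  have hprod : ∀ Γ : Finset G.edgeSet, ∏ e ∈ Γ, inclProb S {e} = p ^ Γ.card := by
    intro Γ; simp [hpS]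
  simp_rw [hprod] at h₁ h₂
  refine add_le_add ?_ ?_
  · calc _ ≤ ∑ Γ : Finset G.edgeSet with IsPartialMatching Γ,
          m⁻¹ * (ρ₁ ^ 2 * p ^ 2 * σ) ^ Γ.card := by
          refine Finset.sum_le_sum fun Γ hΓ => ?_
          simp only [Finset.mem_filter, Finset.mem_univ, true_and] at hΓ
          have hpk : 0 < p ^ Γ.card := by positivity
          have h := pow_le_pow_left₀ (abs_nonneg _) (h₁ Γ hΓ) 2
          rw [sq_abs, div_pow, Real.sq_sqrt hm.le] at h
          have e : (inclProb S Γ - p ^ Γ.card) ^ 2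
              = (p ^ Γ.card) ^ 2 * (inclProb S Γ / p ^ Γ.card - 1) ^ 2 := by
            field_simp
          rw [e]
          calc _ ≤ (p ^ Γ.card) ^ 2 * ((ρ₁ ^ Γ.card) ^ 2 / m) * σ ^ Γ.card := by gcongr
            _ = _ := by rw [mul_pow, mul_pow]; ring
      _ ≤ ∑ Γ : Finset G.edgeSet, m⁻¹ * (ρ₁ ^ 2 * p ^ 2 * σ) ^ Γ.card :=
          Finset.sum_le_sum_of_subset_of_nonneg (Finset.subset_univ _)
            fun _ _ _ => by positivity
      _ = _ := by
          have := Fintype.sum_pow_mul_eq_add_pow G.edgeSet (ρ₁ ^ 2 * p ^ 2 * σ) 1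
          simp only [one_pow, mul_one] at this
          rw [← Finset.mul_sum, this, add_comm]
  · refine le_trans (Finset.sum_le_sum fun Γ hΓ => ?_)
      (sum_pow_card_not_isPartialMatching_le (q := ρ₂ ^ 2 * p ^ 2 * σ) (by positivity))
    simp only [Finset.mem_filter, Finset.mem_univ, true_and] at hΓ
    have hpk : 0 < p ^ Γ.card := by positivity
    have hρk : 1 ≤ ρ₂ ^ Γ.card := one_le_pow₀ hρ₂
    have h0 := inclProb_nonneg S Γ
    have hle : inclProb S Γ ≤ ρ₂ ^ Γ.card * p ^ Γ.card := by
      by_cases hex : ∃ π ∈ S, Γ ⊆ π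
      · exact h₂ Γ hex hΓ
      · rw [inclProb_eq_zero hex]; positivity
    -- Both terms lie between 0 and ρ₂^k p^k; for p^k this is where ρ₂ ≥ 1 enters.
    have habs : |inclProb S Γ - p ^ Γ.card| ≤ ρ₂ ^ Γ.card * p ^ Γ.card := by
      rw [abs_le]; constructor <;> nlinarith
    have h := pow_le_pow_left₀ (abs_nonneg _) habs 2
    rw [sq_abs] at h
    calc _ ≤ (ρ₂ ^ Γ.card * p ^ Γ.card) ^ 2 * σ ^ Γ.card := by gcongr
      _ = _ := by rw [mul_pow, mul_pow]; ring

end Combinatorics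

/-! ### Orthogonality of monomials in independent centred variables. -/

section Orthogonality

variable {E : Type*} [Fintype E] {ν : Measure ℝ} [IsProbabilityMeasure ν]

open Classical in
-- The integral factors over coordinates: an index in both sets contributes the second moment, one
-- in neither contributes 1, and one in exactly one set contributes the mean, which is 0.
theorem integrable_and_integral_prod_mul_prod (h2 : MemLp id 2 ν) (h0 : ∫ x, x ∂ν = 0)
    (Γ Δ : Finset E) :
    Integrable (fun x : E → ℝ => (∏ e ∈ Γ, x e) * ∏ e ∈ Δ, x e) (Measure.pi fun _ => ν) ∧
    ∫ x : E → ℝ, (∏ e ∈ Γ, x e) * ∏ e ∈ Δ, x e ∂(Measure.pi fun _ => ν)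
      = if Γ = Δ then (∫ x, x ^ 2 ∂ν) ^ Γ.card else 0 := by
  have hint1 : Integrable (fun x : ℝ => x) ν := h2.integrable one_le_two
  have hint2 : Integrable (fun x : ℝ => x ^ 2) ν := h2.integrable_sq
  set f : E → ℝ → ℝ := fun e y => (if e ∈ Γ then y else 1) * (if e ∈ Δ then y else 1)
  have he : ∀ x : E → ℝ, (∏ e ∈ Γ, x e) * ∏ e ∈ Δ, x e = ∏ e, f e (x e) := by
    intro x
    simp only [f]
    rw [Finset.prod_mul_distrib]
    simp [Finset.prod_ite_mem]
  simp_rw [he]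
  have hf : ∀ e, Integrable (f e) ν := by
    intro e
    by_cases h : e ∈ Γ <;> by_cases h' : e ∈ Δ <;> simp [f, h, h', ← pow_two, hint1, hint2]
  refine ⟨Integrable.fintype_prod hf, ?_⟩
  rw [integral_fintype_prod_eq_prod]
  split_ifs with h
  · subst h
    have : ∀ e, ∫ y, f e y ∂ν = if e ∈ Γ then ∫ x, x ^ 2 ∂ν else 1 := by
      intro e
      by_cases h : e ∈ Γ <;> simp [f, h, ← pow_two]
    simp_rw [this]
    simp [Finset.prod_ite_mem]
  · obtain ⟨e, he⟩ : ∃ e, ¬ (e ∈ Γ ↔ e ∈ Δ) := by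
      by_contra hcon
      push Not at hcon
      exact h (Finset.ext hcon)
    refine Finset.prod_eq_zero (Finset.mem_univ e) ?_
    by_cases h : e ∈ Γ <;> by_cases h' : e ∈ Δ <;> simp_all [f]

open Classical in
/-- Multilinear polynomials in independent centred variables: orthogonality of the monomials. -/
theorem integral_sq_multilinear (h2 : MemLp id 2 ν) (h0 : ∫ x, x ∂ν = 0) (b : Finset E → ℝ) :
    MemLp (fun x : E → ℝ => ∑ Γ, b Γ * ∏ e ∈ Γ, x e) 2 (Measure.pi fun _ => ν) ∧
    ∫ x : E → ℝ, (∑ Γ, b Γ * ∏ e ∈ Γ, x e) ^ 2 ∂(Measure.pi fun _ => ν)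
      = ∑ Γ, b Γ ^ 2 * (∫ x, x ^ 2 ∂ν) ^ Γ.card := by
  have key := integrable_and_integral_prod_mul_prod (E := E) h2 h0
  have he : ∀ x : E → ℝ, (∑ Γ, b Γ * ∏ e ∈ Γ, x e) ^ 2
      = ∑ Γ, ∑ Δ, (b Γ * b Δ) * ((∏ e ∈ Γ, x e) * ∏ e ∈ Δ, x e) := by
    intro x
    rw [pow_two, Finset.sum_mul_sum]
    refine Finset.sum_congr rfl fun Γ _ => Finset.sum_congr rfl fun Δ _ => by ring
  constructor
  · rw [memLp_two_iff_integrable_sq (by fun_prop)]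
    simp_rw [he]
    exact integrable_finsetSum _ fun Γ _ => integrable_finsetSum _ fun Δ _ =>
      (key Γ Δ).1.const_mul _
  · simp_rw [he]
    rw [integral_finsetSum _ fun Γ _ => integrable_finsetSum _ fun Δ _ =>
      (key Γ Δ).1.const_mul _]
    refine Finset.sum_congr rfl fun Γ _ => ?_
    rw [integral_finsetSum _ fun Δ _ => (key Γ Δ).1.const_mul _]
    simp_rw [integral_const_mul, (key Γ _).2]
    simp [pow_two]

theorem integrable_and_sq_integral_abs_multilinear_le (h2 : MemLp id 2 ν) (h0 : ∫ x, x ∂ν = 0)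
    {Ω : Type*} [MeasurableSpace Ω] {P : Measure Ω} [IsProbabilityMeasure P] {X : E → Ω → ℝ}
    (hlaw : ∀ e, HasLaw (X e) ν P) (hindep : iIndepFun X P) (b : Finset E → ℝ) :
    Integrable (fun ω => ∑ Γ, b Γ * ∏ e ∈ Γ, X e ω) P ∧
    (∫ ω, |∑ Γ, b Γ * ∏ e ∈ Γ, X e ω| ∂P) ^ 2 ≤ ∑ Γ, b Γ ^ 2 * (∫ x, x ^ 2 ∂ν) ^ Γ.card := by
  have hae := fun e => (hlaw e).aemeasurable
  have hmap : P.map (fun ω e => X e ω) = Measure.pi fun _ => ν := by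
    rw [(iIndepFun_iff_map_fun_eq_pi_map hae).1 hindep]
    simp_rw [(hlaw _).map_eq]
  obtain ⟨hL, hI⟩ := integral_sq_multilinear (E := E) h2 h0 b
  rw [← hmap] at hL hI
  have haeX : AEMeasurable (fun ω e => X e ω) P := by fun_prop
  rw [integral_map haeX (by fun_prop)] at hI
  have hL' : MemLp (fun ω => ∑ Γ, b Γ * ∏ e ∈ Γ, X e ω) 2 P := hL.comp_of_map haeX
  refine ⟨hL'.integrable one_le_two, ?_⟩
  rw [← hI]
  -- Nonnegativity of the variance of |f| gives (E|f|)² ≤ E f².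
  have hv := variance_nonneg (fun ω => |∑ Γ, b Γ * ∏ e ∈ Γ, X e ω|) P
  have habs : MemLp (fun ω => |∑ Γ, b Γ * ∏ e ∈ Γ, X e ω|) 2 P := hL'.abs
  rw [variance_eq_sub habs] at hv
  simp only [Pi.pow_apply, sq_abs] at hv
  linarith

end Orthogonality

/-! ### Boltzmann factors of extended real weights. -/

section Weights

/-- The Boltzmann factor `exp (-β x)` of a weight, divided by its mean and centred. -/
noncomputable def centredFactor (μ : Measure EReal) (β : ℝ) (x : EReal) : ℝ :=
  (EReal.exp (-((β : EReal) * x))).toReal / (laplace μ β).toReal - 1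

theorem exp_neg_coe_mul (β : ℝ) (x : EReal) :
    EReal.exp (-((β : EReal) * x)) = (EReal.exp x ^ β)⁻¹ := by
  rw [EReal.exp_neg, mul_comm, EReal.exp_mul]

theorem measurable_exp_neg_mul (β : ℝ) :
    Measurable fun x : EReal => EReal.exp (-((β : EReal) * x)) := by
  simp_rw [exp_neg_coe_mul]
  exact (EReal.measurable_exp.pow_const β).inv

theorem measurable_centredFactor (μ : Measure EReal) (β : ℝ) : Measurable (centredFactor μ β) :=
  ((measurable_exp_neg_mul β).ennreal_toReal.div_const _).sub_const _

theorem exp_neg_mul_eq_zero_iff {β : ℝ} (hβ : 0 < β) {x : EReal} :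
    EReal.exp (-((β : EReal) * x)) = 0 ↔ x = ⊤ := by
  rw [exp_neg_coe_mul]
  simp [ENNReal.rpow_eq_top_iff, hβ, hβ.not_gt]

theorem exp_neg_two_mul (β : ℝ) (x : EReal) :
    EReal.exp (-(((2 * β : ℝ) : EReal) * x)) = EReal.exp (-((β : EReal) * x)) ^ 2 := by
  rw [← EReal.exp_nmul, EReal.coe_mul, mul_assoc, ← mul_neg]
  rfl

variable {μ : Measure EReal} {β : ℝ}

theorem laplace_ne_zero [IsProbabilityMeasure μ] (hμ : μ {⊤} ≠ 1) (hβ : 0 < β) : laplace μ β ≠ 0 := by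
  intro h
  rw [laplace, lintegral_eq_zero_iff (measurable_exp_neg_mul β)] at h
  refine hμ ?_
  rw [← prob_compl_eq_zero_iff (measurableSet_singleton _)]
  filter_upwards [h] with x hx
  simpa [exp_neg_mul_eq_zero_iff hβ] using hx

theorem ae_exp_neg_mul_lt_top (hL : laplace μ β < ∞) :
    ∀ᵐ x ∂μ, EReal.exp (-((β : EReal) * x)) < ∞ :=
  ae_lt_top (measurable_exp_neg_mul β) hL.ne

/-- The value -∞ is excluded only by finiteness of the Laplace transform, since it would make the
Boltzmann factor infinite. -/
theorem ae_ne_bot (hβ : 0 < β) (hL : laplace μ β < ∞) : ∀ᵐ x ∂μ, x ≠ ⊥ := by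
  filter_upwards [ae_exp_neg_mul_lt_top hL] with x hx h
  subst h
  simp [EReal.coe_mul_bot_of_pos hβ] at hx

theorem integral_exp_neg_mul (hL : laplace μ β < ∞) :
    ∫ x, (EReal.exp (-((β : EReal) * x))).toReal ∂μ = (laplace μ β).toReal :=
  integral_toReal (measurable_exp_neg_mul β).aemeasurable (ae_exp_neg_mul_lt_top hL)

theorem integrable_exp_neg_mul (hL : laplace μ β < ∞) :
    Integrable (fun x : EReal => (EReal.exp (-((β : EReal) * x))).toReal) μ :=
  integrable_toReal_of_lintegral_ne_top (measurable_exp_neg_mul β).aemeasurable hL.ne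

theorem neg_one_le_centredFactor (x : EReal) : -1 ≤ centredFactor μ β x := by
  have : 0 ≤ (EReal.exp (-((β : EReal) * x))).toReal / (laplace μ β).toReal := by positivity
  unfold centredFactor
  linarith

theorem memLp_centredFactor [IsProbabilityMeasure μ] (hL₂ : laplace μ (2 * β) < ∞) : MemLp (centredFactor μ β) 2 μ := by
  have h : MemLp (fun x : EReal => (EReal.exp (-((β : EReal) * x))).toReal) 2 μ := by
    rw [memLp_two_iff_integrable_sq
      (measurable_exp_neg_mul β).ennreal_toReal.aestronglyMeasurable]
    refine (integrable_exp_neg_mul hL₂).congr (ae_of_all _ fun x => ?_)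
    simp only
    rw [exp_neg_two_mul, ENNReal.toReal_pow]
  refine ((h.const_mul (laplace μ β).toReal⁻¹).sub (memLp_const 1)).ae_eq (ae_of_all _ fun x => ?_)
  simp [centredFactor, div_eq_inv_mul]

theorem integral_centredFactor [IsProbabilityMeasure μ] (hμ : μ {⊤} ≠ 1) (hβ : 0 < β)
    (hL : laplace μ β < ∞) :
    ∫ x, centredFactor μ β x ∂μ = 0 := by
  have h0 : (laplace μ β).toReal ≠ 0 := (ENNReal.toReal_pos (laplace_ne_zero hμ hβ) hL.ne).ne'
  simp only [centredFactor]
  rw [integral_sub ((integrable_exp_neg_mul hL).div_const _) (integrable_const _),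
    integral_div, integral_exp_neg_mul hL, div_self h0]
  simp

theorem integral_sq_centredFactor [IsProbabilityMeasure μ] (hμ : μ {⊤} ≠ 1) (hβ : 0 < β)
    (hL : laplace μ β < ∞)    (hL₂ : laplace μ (2 * β) < ∞) : ∫ x, centredFactor μ β x ^ 2 ∂μ = vSq μ β := by
  have h0 : 0 < (laplace μ β).toReal := ENNReal.toReal_pos (laplace_ne_zero hμ hβ) hL.ne
  have h2 : 0 < (laplace μ (2 * β)).toReal :=
    ENNReal.toReal_pos (laplace_ne_zero hμ (by positivity)) hL₂.ne
  have e : ∀ x, centredFactor μ β x ^ 2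
      = (EReal.exp (-(((2 * β : ℝ) : EReal) * x))).toReal / (laplace μ β).toReal ^ 2
        - (2 * centredFactor μ β x + 1) := by
    intro x
    rw [exp_neg_two_mul, ENNReal.toReal_pow, centredFactor]
    field_simp
    ring
  have hX : Integrable (centredFactor μ β) μ := (memLp_centredFactor hL₂).integrable one_le_two
  have hX' : Integrable (fun x => 2 * centredFactor μ β x + 1) μ :=
    (hX.const_mul 2).add (integrable_const _)
  simp_rw [e]
  rw [integral_sub ((integrable_exp_neg_mul hL₂).div_const _) hX',
    integral_add (hX.const_mul 2) (integrable_const _), integral_const_mul,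
    integral_centredFactor hμ hβ hL, integral_div, integral_exp_neg_mul hL₂, vSq, psi, psi,
    Real.exp_sub, Real.exp_log h2, two_mul (Real.log _), Real.exp_add, Real.exp_log h0]
  simp [pow_two]

/-- The value ⊥ must be excluded: in `EReal` ⊥ + ⊤ = ⊥, so the left side would be ∞ while the
product 0 · ∞ is 0. -/
theorem exp_neg_mul_sum {E : Type*} (hβ : 0 < β) {w : E → EReal} {π : Finset E}
    (hw : ∀ e ∈ π, w e ≠ ⊥) :
    EReal.exp (-((β : EReal) * ∑ e ∈ π, w e)) = ∏ e ∈ π, EReal.exp (-((β : EReal) * w e)) := by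
  classical
  have hne : ∀ x : EReal, x ≠ ⊥ → (EReal.exp x) ^ β ≠ 0 := fun x hx => by
    simp [ENNReal.rpow_eq_zero_iff, hx, hβ.not_gt]
  induction π using Finset.induction_on with
  | empty => simp
  | insert a s ha ih =>
    have hs : ∀ e ∈ s, w e ≠ ⊥ := fun e he => hw e (Finset.mem_insert_of_mem he)
    have hsum : ∑ e ∈ s, w e ≠ ⊥ := by
      clear ih hw ha
      induction s using Finset.induction_on with
      | empty => simp
      | insert b t hb iht =>
        rw [Finset.sum_insert hb]
        exact EReal.add_ne_bot_iff.2 ⟨hs b (Finset.mem_insert_self _ _),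
          iht fun e he => hs e (Finset.mem_insert_of_mem he)⟩
    rw [Finset.sum_insert ha, Finset.prod_insert ha, ← ih hs, exp_neg_coe_mul,
      exp_neg_coe_mul, exp_neg_coe_mul, EReal.exp_add,
      ENNReal.mul_rpow_of_nonneg _ _ hβ.le,
      ENNReal.mul_inv (Or.inl (hne _ (hw a (Finset.mem_insert_self _ _)))) (Or.inr (hne _ hsum))]

/-- The partition function as a multilinear polynomial in the centred Boltzmann factors. -/
theorem log_partitionFn_sub [IsProbabilityMeasure μ] (hμ : μ {⊤} ≠ 1) (hβ : 0 < β)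
    (hL : laplace μ β < ∞)
    {V : Type*} {G : SimpleGraph V} [Fintype G.edgeSet] {S : Finset (Finset G.edgeSet)} {m : ℕ}
    (hS : S.Nonempty) (hm : ∀ π ∈ S, π.card = m)
    {w : G.edgeSet → EReal} (hw : ∀ e, w e ≠ ⊥) :
    ENNReal.log (partitionFn S β w) - (((m : ℝ) * psi μ β : ℝ) : EReal)
      = ENNReal.log (ENNReal.ofReal
        (∑ Γ : Finset G.edgeSet, inclProb S Γ * ∏ e ∈ Γ, centredFactor μ β (w e))) := by
  have h0 : 0 < (laplace μ β).toReal := ENNReal.toReal_pos (laplace_ne_zero hμ hβ) hL.ne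
  set ℓ := (laplace μ β).toReal
  have hfin : ∀ e, EReal.exp (-((β : EReal) * w e)) ≠ ∞ := fun e h => by
    rw [EReal.exp_eq_top_iff, EReal.neg_eq_top_iff] at h
    induction h' : w e with
    | bot => exact hw e h'
    | top => rw [h', EReal.coe_mul_top_of_pos hβ] at h; exact absurd h (by simp)
    | coe x => rw [h', ← EReal.coe_mul] at h; exact absurd h (EReal.coe_ne_bot _)
  have hfac : ∀ e, EReal.exp (-((β : EReal) * w e))
      = ENNReal.ofReal (ℓ * (1 + centredFactor μ β (w e))) := fun e => by
    rw [centredFactor, add_sub_cancel, mul_div_cancel₀ _ h0.ne', ENNReal.ofReal_toReal (hfin e)]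
  have hnn : ∀ e, 0 ≤ 1 + centredFactor μ β (w e) := fun e => by
    linarith [neg_one_le_centredFactor (μ := μ) (β := β) (w e)]
  have hZ : partitionFn S β w = ENNReal.ofReal (ℓ ^ m) * ENNReal.ofReal
      (∑ Γ : Finset G.edgeSet, inclProb S Γ * ∏ e ∈ Γ, centredFactor μ β (w e)) := by
    rw [← inv_card_mul_sum_prod_one_add, ← ENNReal.ofReal_mul (by positivity), partitionFn]
    have hc : (S.card : ℝ≥0∞)⁻¹ = ENNReal.ofReal (S.card : ℝ)⁻¹ := by
      rw [ENNReal.ofReal_inv_of_pos (by exact_mod_cast hS.card_pos), ENNReal.ofReal_natCast]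
    rw [mul_left_comm, ENNReal.ofReal_mul (by positivity), ← hc]
    congr 1
    rw [Finset.mul_sum, ENNReal.ofReal_sum_of_nonneg fun π _ =>
      mul_nonneg (by positivity) (Finset.prod_nonneg fun e _ => hnn e)]
    refine Finset.sum_congr rfl fun π hπ => ?_
    rw [weight, exp_neg_mul_sum hβ fun e _ => hw e, Finset.prod_congr rfl fun e _ => hfac e,
      ← ENNReal.ofReal_prod_of_nonneg fun e _ => mul_nonneg h0.le (hnn e),
      Finset.prod_mul_distrib, Finset.prod_const, hm π hπ]
  rw [hZ, ENNReal.log_mul_add, ENNReal.log_ofReal_of_pos (by positivity), Real.log_pow, psi,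
    EReal.add_sub_cancel_left]

end Weights

/-! ### Asymptotics of the parameters and of the variance bound. -/

section Asymptotics

theorem tendsto_of_tendsto_sq_zero {f : ℕ → ℝ} (hf : Tendsto (fun n => f n ^ 2) atTop (𝓝 0)) :
    Tendsto f atTop (𝓝 0) := by
  have := (Real.continuous_sqrt.tendsto 0).comp hf
  rw [Real.sqrt_zero] at this
  exact (tendsto_zero_iff_abs_tendsto_zero f).2 (this.congr fun n => Real.sqrt_sq_eq_abs _)

theorem one_add_pow_le_exp {q : ℝ} (hq : 0 ≤ q) (N : ℕ) : (1 + q) ^ N ≤ Real.exp (q * N) := by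
  rw [mul_comm, Real.exp_nat_mul]
  exact pow_le_pow_left₀ (by linarith) (by linarith [Real.add_one_le_exp q]) N

/-- Growth of the number of edges of a sequence of dense graphs, and of the size of the
configurations. -/
theorem dense_asymptotics {v N m : ℕ → ℕ} {c : ℕ} {γ : ℝ} (hγ : 0 < γ)
    (hv : ∀ᶠ n in atTop, v n = c * n)
    (hN : (fun n => (N n : ℝ)) =Θ[atTop] fun n => (v n : ℝ) ^ 2)
    (hm : Tendsto (fun n => (m n : ℝ) ^ 2 / (2 * (N n : ℝ))) atTop (𝓝 γ)) :
    Tendsto (fun n => (m n : ℝ) / N n) atTop (𝓝[>] 0) ∧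
    Tendsto (fun n => ((m n : ℝ) / N n) ^ 2 * N n) atTop (𝓝 (2 * γ)) ∧
    Tendsto (fun n => (m n : ℝ)⁻¹) atTop (𝓝 0) ∧
    Tendsto (fun n => (v n : ℝ) / N n) atTop (𝓝 0) ∧
    ∀ᶠ n in atTop, 0 < N n ∧ 0 < m n := by
  -- If N or m vanished, the ratio m²/(2N) would be 0 (division by zero included), against its limit
  -- γ > 0.
  have hpos : ∀ᶠ n in atTop, 0 < N n ∧ 0 < m n := by
    filter_upwards [hm.eventually_const_lt hγ] with n hn
    constructor <;> (refine Nat.pos_of_ne_zero fun h => ?_) <;> simp [h] at hn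
  -- If c = 0, then v = 0 and N = O(v²) forces N = 0.
  have hc : 0 < c := by
    refine Nat.pos_of_ne_zero fun h => ?_
    obtain ⟨C, hC⟩ := hN.1.bound
    obtain ⟨n, hn, hvn, hCn⟩ := (hpos.and (hv.and hC)).exists
    simp [hvn, h] at hCn
    omega
  have hvtop : Tendsto (fun n => (v n : ℝ)) atTop atTop := by
    refine tendsto_natCast_atTop_atTop.comp ((tendsto_id.const_mul_atTop' hc).congr' ?_)
    filter_upwards [hv] with n hn
    exact hn.symm
  obtain ⟨C, hC0, hC⟩ := hN.2.exists_pos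
  have hC' := hC.bound
  have hvN : Tendsto (fun n => (v n : ℝ) / N n) atTop (𝓝 0) := by
    refine squeeze_zero' (Eventually.of_forall fun n => by positivity) ?_
      (by simpa using hvtop.inv_tendsto_atTop.const_mul C)
    filter_upwards [hC', hpos, hvtop.eventually_gt_atTop 0] with n hn hNn hvn
    rw [div_le_iff₀ (by exact_mod_cast hNn.1)]
    simp only [norm_pow, Real.norm_natCast] at hn
    calc (v n : ℝ) = (v n : ℝ)⁻¹ * (v n : ℝ) ^ 2 := by field_simp
      _ ≤ (v n : ℝ)⁻¹ * (C * N n) := by gcongr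
      _ = _ := by ring
  have hNinv : Tendsto (fun n => (N n : ℝ)⁻¹) atTop (𝓝 0) := by
    have := hvN.mul hvtop.inv_tendsto_atTop
    rw [zero_mul] at this
    refine this.congr' ?_
    filter_upwards [hvtop.eventually_gt_atTop 0] with n hvn
    simp only [Pi.inv_apply]
    field_simp
  have hR : Tendsto (fun n => ((m n : ℝ) / N n) ^ 2 * N n) atTop (𝓝 (2 * γ)) := by
    refine (hm.const_mul 2).congr' ?_
    filter_upwards [hpos] with n hn
    have : (N n : ℝ) ≠ 0 := by exact_mod_cast hn.1.ne'
    field_simp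
  refine ⟨tendsto_nhdsWithin_iff.2 ⟨tendsto_of_tendsto_sq_zero ?_, ?_⟩, hR,
    tendsto_of_tendsto_sq_zero ?_, hvN, hpos⟩
  · have := hR.mul hNinv
    rw [mul_zero] at this
    refine this.congr' ?_
    filter_upwards [hpos] with n hn
    have : (N n : ℝ) ≠ 0 := by exact_mod_cast hn.1.ne'
    field_simp
  · filter_upwards [hpos] with n hn
    have h1 : (0 : ℝ) < N n := by exact_mod_cast hn.1
    have h2 : (0 : ℝ) < m n := by exact_mod_cast hn.2
    exact div_pos h2 h1
  -- Here m⁻² = ½ (m²/(2N))⁻¹ N⁻¹.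
  · have := (hm.inv₀ hγ.ne').mul hNinv
    rw [mul_zero] at this
    have := this.const_mul (1 / 2)
    rw [mul_zero] at this
    refine this.congr' ?_
    filter_upwards [hpos] with n hn
    have h1 : (N n : ℝ) ≠ 0 := by exact_mod_cast hn.1.ne'
    have h2 : (m n : ℝ) ≠ 0 := by exact_mod_cast hn.2.ne'
    field_simp

/-- With q = ρ²p²σ, the product qN converges, so (1 + q)^N stays bounded. The first summand is then
O(1/m), and in the second N · 2v · q² = 2(v/N)(qN)² → 0. -/
theorem tendsto_variance_bound {v N : ℕ → ℕ} {p m : ℕ → ℝ} {γ : ℝ}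
    (hpN : Tendsto (fun n => p n ^ 2 * N n) atTop (𝓝 (2 * γ)))
    (hm : Tendsto (fun n => (m n)⁻¹) atTop (𝓝 0)) (hm0 : ∀ᶠ n in atTop, 0 < m n)
    (hvN : Tendsto (fun n => (v n : ℝ) / N n) atTop (𝓝 0))
    (ρ₁ ρ₂ : ℝ) {σ : ℝ} (hσ : 0 ≤ σ) :
    Tendsto (fun n => (m n)⁻¹ * (1 + ρ₁ ^ 2 * p n ^ 2 * σ) ^ N n +
        N n * (2 * v n) * ((ρ₂ ^ 2 * p n ^ 2 * σ) ^ 2 * (1 + ρ₂ ^ 2 * p n ^ 2 * σ) ^ N n))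
      atTop (𝓝 0) := by
  have hq : ∀ ρ : ℝ, Tendsto (fun n => ρ ^ 2 * p n ^ 2 * σ * N n) atTop
      (𝓝 (ρ ^ 2 * (2 * γ) * σ)) := fun ρ =>
    ((hpN.const_mul (ρ ^ 2)).mul_const σ).congr fun n => by ring
  have hexp := fun ρ => (Real.continuous_exp.tendsto _).comp (hq ρ)
  have h1 := hm.mul (hexp ρ₁)
  have h2 := ((hvN.const_mul 2).mul ((hq ρ₂).pow 2)).mul (hexp ρ₂)
  have h := h1.add h2
  rw [mul_zero, zero_mul, zero_mul, zero_mul, zero_add] at h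
  refine squeeze_zero' ?_ ?_ h
  · filter_upwards [hm0] with n hn
    positivity
  · filter_upwards [hm0] with n hn
    refine add_le_add ?_ ?_
    · gcongr
      exact one_add_pow_le_exp (by positivity) _
    · rcases Nat.eq_zero_or_pos (N n) with h0 | h0
      · simp [h0]
      have h0' : (N n : ℝ) ≠ 0 := by exact_mod_cast h0.ne'
      calc _ ≤ N n * (2 * v n) * ((ρ₂ ^ 2 * p n ^ 2 * σ) ^ 2 *
            Real.exp (ρ₂ ^ 2 * p n ^ 2 * σ * N n)) := by
            gcongr
            exact one_add_pow_le_exp (by positivity) _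
        _ = _ := by
            simp only [Function.comp]
            field_simp

end Asymptotics

end RandomOpt

/-! ### The limit theorem. -/

theorem theorem2p2
    -- the dense edge-transitive graphs `G n` on `c * n` vertices
    {V : ℕ → Type*} [∀ n, Finite (V n)] (G : ∀ n, SimpleGraph (V n)) (c : ℕ)
    (hG_trans : ∀ᶠ n in atTop, RandomOpt.IsEdgeTransitive (G n))
    (hG_card : ∀ᶠ n in atTop, Nat.card (V n) = c * n)
    (hG_dense : (fun n => (Nat.card (G n).edgeSet : ℝ)) =Θ[atTop]
      (fun n => (Nat.card (V n) : ℝ) ^ 2))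
    -- the i.i.d. weights, with values in `(-∞, +∞]`
    {Ω : ℕ → Type*} [∀ n, MeasurableSpace (Ω n)]
    (P : ∀ n, Measure (Ω n)) [∀ n, IsProbabilityMeasure (P n)]
    (μ : Measure EReal) [IsProbabilityMeasure μ]
    (ω : ∀ n, (G n).edgeSet → Ω n → EReal)
    (hω_law : ∀ n e, HasLaw (ω n e) μ (P n))
    (hω_indep : ∀ n, iIndepFun (ω n) (P n))
    (hμ_top : μ {⊤} ≠ 1)
    (hμ_laplace : ∀ β : ℝ, 0 < β → RandomOpt.laplace μ β < ∞)
    -- the family of configurations, all with `m n` edges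
    (S : ∀ n, Finset (Finset (G n).edgeSet)) (m : ℕ → ℕ) (γ : ℝ) (hγ : 0 < γ)
    (hS_card : ∀ᶠ n in atTop, ∀ π ∈ S n, π.card = m n)
    (hS_lim : Tendsto (fun n => (m n : ℝ) ^ 2 / (2 * (Nat.card (G n).edgeSet : ℝ))) atTop (𝓝 γ))
    -- all edges are equally likely to be in a uniformly chosen configuration
    (hS_edge : ∀ᶠ n in atTop, ∀ e f : (G n).edgeSet,
      RandomOpt.inclProb (S n) {e} = RandomOpt.inclProb (S n) {f})
    -- partial matchings extend to configurations
    (hS_ext : ∀ᶠ n in atTop, ∀ Γ : Finset (G n).edgeSet,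
      RandomOpt.IsPartialMatching Γ → ∃ π ∈ S n, Γ ⊆ π)
    -- near-product inclusion probabilities for partial matchings
    (hS_prod : ∃ ρ : ℝ, 0 < ρ ∧ ∀ᶠ n in atTop, ∀ Γ : Finset (G n).edgeSet,
      RandomOpt.IsPartialMatching Γ →
        |RandomOpt.inclProb (S n) Γ / (∏ e ∈ Γ, RandomOpt.inclProb (S n) {e}) - 1|
          ≤ ρ ^ Γ.card / Real.sqrt (m n))
    -- bound for the other subgraphs of configurations
    (hS_non : ∃ ρ : ℝ, 0 < ρ ∧ ∀ᶠ n in atTop, ∀ Γ : Finset (G n).edgeSet,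
      (∃ π ∈ S n, Γ ⊆ π) → ¬ RandomOpt.IsPartialMatching Γ →
        RandomOpt.inclProb (S n) Γ ≤ ρ ^ Γ.card * ∏ e ∈ Γ, RandomOpt.inclProb (S n) {e})
    (β : ℝ) (hβ : 0 < β) :
    -- weak convergence of laws on the extended line (`log Z(β) = -∞` when `Z(β) = 0`)
    TendstoInDistribution
      (fun n x => ENNReal.log (RandomOpt.partitionFn (S n) β (fun e => ω n e x))
        - (((m n : ℝ) * RandomOpt.psi μ β : ℝ) : EReal))
      atTop
      (fun x : ℝ => (x : EReal))
      P
      (gaussianReal (-(γ * RandomOpt.vSq μ β)) (2 * γ * RandomOpt.vSq μ β).toNNReal) := by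
  classical
  let _ : ∀ n, Fintype (V n) := fun n => Fintype.ofFinite _
  let _ : ∀ n, Fintype (G n).edgeSet := fun n => Fintype.ofFinite _
  simp only [Nat.card_eq_fintype_card] at hG_card hG_dense hS_lim
  have hL := hμ_laplace β hβ
  have hL₂ := hμ_laplace (2 * β) (by positivity)
  set N : ℕ → ℕ := fun n => Fintype.card (G n).edgeSet
  set p : ℕ → ℝ := fun n => (m n : ℝ) / N n with hp
  obtain ⟨hp0, hpN, hm_inv, hvN, hpos⟩ :=
    RandomOpt.dense_asymptotics (v := fun n => Fintype.card (V n)) (N := N) hγ hG_card hG_dense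
      hS_lim
  -- the centred weights and their law
  set X : ∀ n, (G n).edgeSet → Ω n → ℝ := fun n e x => RandomOpt.centredFactor μ β (ω n e x) with hX
  have hcm := RandomOpt.measurable_centredFactor μ β
  set ν : Measure ℝ := μ.map (RandomOpt.centredFactor μ β)
  have : IsProbabilityMeasure ν := Measure.isProbabilityMeasure_map hcm.aemeasurable
  have hlaw : ∀ n e, HasLaw (X n e) ν (P n) := fun n e =>
    HasLaw.comp (Y := RandomOpt.centredFactor μ β) ⟨hcm.aemeasurable, rfl⟩ (hω_law n e)
  have hindep : ∀ n, iIndepFun (X n) (P n) := fun n =>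
    (hω_indep n).comp (fun _ => RandomOpt.centredFactor μ β) fun _ => hcm
  have hν1 : ∀ᵐ x ∂ν, -1 ≤ x :=
    (ae_map_iff hcm.aemeasurable measurableSet_Ici).2
      (ae_of_all _ RandomOpt.neg_one_le_centredFactor)
  have hν2 : MemLp id 2 ν :=
    (memLp_map_measure_iff aestronglyMeasurable_id hcm.aemeasurable).2
      (RandomOpt.memLp_centredFactor hL₂)
  have hν0 : ∫ x, x ∂ν = 0 := by
    rw [integral_map hcm.aemeasurable (by fun_prop)]
    exact RandomOpt.integral_centredFactor hμ_top hβ hL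
  have hνv : ∫ x, x ^ 2 ∂ν = RandomOpt.vSq μ β := by
    rw [integral_map hcm.aemeasurable (by fun_prop)]
    exact RandomOpt.integral_sq_centredFactor hμ_top hβ hL hL₂
  have hσ : 0 ≤ ∫ x, x ^ 2 ∂ν := integral_nonneg fun x => sq_nonneg x
  -- the limit theorem for the product over all edges
  have hclt := RandomOpt.tendstoInDistribution_sum_log_one_add hlaw hindep hν1 hν2 hν0 hp0 hγ.le hpN
  rw [hνv] at hclt
  -- the difference is negligible
  set b : ∀ n, Finset (G n).edgeSet → ℝ := fun n Γ =>
    RandomOpt.inclProb (S n) Γ - p n ^ Γ.card with hb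
  -- For large n this is almost surely e^{-mψ(β)} Z(β) - ∏_e (1 + p X_e).
  set D : ∀ n, Ω n → ℝ := fun n x => ∑ Γ, b n Γ * ∏ e ∈ Γ, X n e x
  have hDint := fun n => RandomOpt.integrable_and_sq_integral_abs_multilinear_le hν2 hν0 (hlaw n)
    (hindep n) (b n)
  have hS_ne : ∀ᶠ n in atTop, (S n).Nonempty := by
    filter_upwards [hS_ext] with n hn
    obtain ⟨π, hπ, -⟩ := hn ∅ (by simp [RandomOpt.IsPartialMatching])
    exact ⟨π, hπ⟩
  have hinc : ∀ᶠ n in atTop, ∀ e : (G n).edgeSet, RandomOpt.inclProb (S n) {e} = p n := by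
    filter_upwards [hS_ne, hS_card, hS_edge, hpos] with n hne hcard hedge hpn e
    have h := RandomOpt.sum_inclProb_singleton hne hcard
    rw [Finset.sum_congr rfl fun f _ => hedge f e, Finset.sum_const, nsmul_eq_mul,
      Finset.card_univ] at h
    have hN0 : (N n : ℝ) ≠ 0 := by exact_mod_cast hpn.1.ne'
    rw [hp]
    field_simp
    rw [← h, mul_comm]
  have hD0 : Tendsto (fun n => ∫ x, |D n x| ∂(P n)) atTop (𝓝 0) := by
    obtain ⟨ρ₁, -, h₁⟩ := hS_prod
    obtain ⟨ρ₂, hρ₂, h₂⟩ := hS_non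
    -- The constant for non-matchings is enlarged to `max ρ₂ 1`, so that its powers times p^k also
    -- dominate p^k.
    refine RandomOpt.tendsto_of_tendsto_sq_zero (squeeze_zero' (Eventually.of_forall fun n =>
      sq_nonneg _) ?_ (RandomOpt.tendsto_variance_bound hpN hm_inv
        (hpos.mono fun n hn => by exact_mod_cast hn.2) hvN ρ₁ (max ρ₂ 1) hσ))
    filter_upwards [h₁, h₂, hinc, hpos] with n h₁ h₂ hinc hpn
    have hm0 : (0 : ℝ) < m n := by exact_mod_cast hpn.2
    have hN0 : (0 : ℝ) < N n := by exact_mod_cast hpn.1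
    refine (hDint n).2.trans (RandomOpt.sum_sq_inclProb_sub_pow_le (div_pos hm0 hN0) hm0 hσ
      (le_max_right _ _) hinc h₁ fun Γ hΓ hΓ' => (h₂ Γ hΓ hΓ').trans ?_)
    refine mul_le_mul_of_nonneg_right (pow_le_pow_left₀ hρ₂.le (le_max_left _ _) _)
      (Finset.prod_nonneg fun e _ => RandomOpt.inclProb_nonneg _ _)
  have hpair := RandomOpt.tendstoInDistribution_prodMk_of_tendsto_integral_abs hclt
    (fun n => (hDint n).1) hD0
  -- Continuity into `EReal` holds even where e^{z₁} + z₂ ≤ 0: `ENNReal.ofReal` truncates at 0 and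
  -- log 0 = -∞. At the limit points (x, 0) the value is x.
  have hcont : Continuous fun z : ℝ × ℝ => ENNReal.log (ENNReal.ofReal (Real.exp z.1 + z.2)) :=
    ENNReal.continuous_log.comp (ENNReal.continuous_ofReal.comp (by fun_prop))
  have hlim := hpair.continuous_comp hcont
  have hZ : ((fun z : ℝ × ℝ => ENNReal.log (ENNReal.ofReal (Real.exp z.1 + z.2))) ∘
      fun x : ℝ => (x, (0 : ℝ))) = fun x : ℝ => (x : EReal) := by
    funext x
    simp [Real.exp_pos]
  rw [hZ] at hlim
  refine RandomOpt.tendstoInDistribution_congr_eventually hlim (fun n => ?_) ?_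
  · have hωm := fun e => (hω_law n e).aemeasurable
    have hw : AEMeasurable (fun x => RandomOpt.partitionFn (S n) β fun e => ω n e x) (P n) := by
      refine AEMeasurable.const_mul (Finset.aemeasurable_fun_sum _ fun π _ => ?_) _
      exact (RandomOpt.measurable_exp_neg_mul β).comp_aemeasurable
        (Finset.aemeasurable_fun_sum _ fun e _ => hωm e)
    simp_rw [sub_eq_add_neg]
    exact (ENNReal.measurable_log.comp_aemeasurable hw).add_const _
  -- Since X_e ≥ -1, the bound p < 1 makes 1 + pX_e > 0, so exponentiating the sum of logarithms
  -- returns the product, whose expansion has coefficients p^|Γ|.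
  · have hp1 : ∀ᶠ n in atTop, p n < 1 :=
      (hp0.mono_right nhdsWithin_le_nhds).eventually_lt_const one_pos
    have hp0' : ∀ᶠ n in atTop, 0 < p n := hp0.eventually self_mem_nhdsWithin
    filter_upwards [hS_ne, hS_card, hp1, hp0'] with n hne hcard hp1 hp0
    have hbot : ∀ᵐ x ∂(P n), ∀ e, ω n e x ≠ ⊥ := by
      refine ae_all_iff.2 fun e => ?_
      have h := RandomOpt.ae_ne_bot hβ hL
      rw [← (hω_law n e).map_eq] at h
      exact ae_of_ae_map (hω_law n e).aemeasurable h
    filter_upwards [hbot] with x hx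
    rw [RandomOpt.log_partitionFn_sub hμ_top hβ hL hne hcard hx]
    simp only [Function.comp]
    congr 2
    have h1 : ∀ e, 0 < 1 + p n * X n e x := fun e => by
      have : -1 ≤ X n e x := RandomOpt.neg_one_le_centredFactor _
      nlinarith
    rw [Real.exp_sum, Finset.prod_congr rfl fun e _ => Real.exp_log (h1 e), Finset.prod_one_add,
      Finset.powerset_univ, ← Finset.sum_add_distrib]
    refine Finset.sum_congr rfl fun Γ _ => ?_
    simp only [hb, hX, Finset.prod_mul_distrib, Finset.prod_const]
    ring
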